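/- Let $\mathbf{x}_0\in\mathbb{R}^n$ and let $\mathbf{v}\sim\mathcal{N}(0,\mathbf{I}_n)$ be a standard Gaussian vector. For a nonempty set $A\subseteq\mathbb{R}^n$ write $\mathrm{cone}(A)=\{t\mathbf{a}: \mathbf{a}\in A,\ t\ge 0\}$, $A^*=\{\mathbf{u}:\langle \mathbf{u},\mathbf{a}\rangle\le 0\text{ for all }\mathbf{a}\in A\}$ for the polar cone, and $\mathbf{D}(A)=\mathbb{E}[\mathrm{dist}(\mathbf{g},A)^2]$ with $\mathbf{g}\sim\mathcal{N}(0,\mathbf{I}_n)$ and $\mathrm{dist}$ the Euclidean distance. (a) Let $\mathcal{C}\subseteq\mathbb{R}^n$ be a nonempty closed convex set with $\mathbf{x}_0\in\mathcal{C}$, let $\mathrm{prox}_{\mathcal{C}}(\mathbf{y})=\arg\min_{\mathbf{x}\in\mathcal{C}}\|\mathbf{y}-\mathbf{x}\|_2$ be the projection onto $\mathcal{C}$, and let $T_{\mathcal{C}}(\mathbf{x}_0)$ be the closure of $\mathrm{cone}(\{\mathbf{z}:\mathbf{x}_0+\mathbf{z}\in\mathcal{C}\})$. Then for every $\sigma>0$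 the expectation $\mathbb{E}[\|\mathrm{prox}_{\mathcal{C}}(\mathbf{x}_0+\sigma\mathbf{v})-\mathbf{x}_0\|_2^2]$ is finite, and $$\sup_{\sigma>0}\frac{\mathbb{E}\left[\|\mathrm{prox}_{\mathcal{C}}(\mathbf{x}_0+\sigma\mathbf{v})-\mathbf{x}_0\|_2^2\right]}{\sigma^2}=\lim_{\sigma\downarrow 0}\frac{\mathbb{E}\left[\|\mathrm{prox}_{\mathcal{C}}(\mathbf{x}_0+\sigma\mathbf{v})-\mathbf{x}_0\|_2^2\right]}{\sigma^2}=\mathbf{D}(T_{\mathcal{C}}(\mathbf{x}_0)^*).$$ (b) Let $f:\mathbb{R}^n\to\mathbb{R}$ be a convex function such that $\mathbf{x}_0$ is not a minimizer of $f$, let $\partial f(\mathbf{x}_0)$ be the set of subgradients of $f$ at $\mathbf{x}_0$, and let $T_f(\mathbf{x}_0)$ be the closure of $\mathrm{cone}(\{\mathbf{z}: f(\mathbf{x}_0+\mathbf{z})\le f(\mathbf{x}_0)\})$. Then for $\mathcal{C}=\{\mathbf{x}\in\mathbb{R}^n: f(\mathbf{x})\le f(\mathbf{x}_0)\}$ these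 expectations are finite for every $\sigma>0$, and $$\sup_{\sigma>0}\frac{\mathbb{E}\left[\|\mathrm{prox}_{\mathcal{C}}(\mathbf{x}_0+\sigma\mathbf{v})-\mathbf{x}_0\|_2^2\right]}{\sigma^2}=\lim_{\sigma\downarrow 0}\frac{\mathbb{E}\left[\|\mathrm{prox}_{\mathcal{C}}(\mathbf{x}_0+\sigma\mathbf{v})-\mathbf{x}_0\|_2^2\right]}{\sigma^2}=\mathbf{D}(T_f(\mathbf{x}_0)^*)=\mathbf{D}(\mathrm{cone}(\partial f(\mathbf{x}_0))).$$ -/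

import Mathlib

open Set Filter Topology MeasureTheory ProbabilityTheory
open scoped RealInnerProductSpace

namespace ConvexDenoising

section Geometry

variable {E : Type*} [NormedAddCommGroup E] [InnerProductSpace ℝ E]

/-- `x` is a minimizer of `z ↦ ‖y - z‖` over the set `C`. -/
def IsNearestPoint (C : Set E) (y x : E) : Prop :=
  x ∈ C ∧ ∀ z ∈ C, ‖y - x‖ ≤ ‖y - z‖

open Classical in
/-- `prox C y = argmin_{x ∈ C} ‖y - x‖`. For a nonempty closed convex set `C` the minimizer exists
and is unique, see `isNearestPoint_prox` and `IsNearestPoint.eq_prox`. (The value is `y` if there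
is no minimizer.) -/
noncomputable def prox (C : Set E) (y : E) : E :=
  if h : ∃ x, IsNearestPoint C y x then h.choose else y

/-- The cone generated by `A`: all `t • a` with `a ∈ A` and `t ≥ 0`. -/
def coneOf (A : Set E) : Set E :=
  {z | ∃ a ∈ A, ∃ t : ℝ, 0 ≤ t ∧ z = t • a}

/-- The polar cone: all `v` with `⟪v, x⟫ ≤ 0` for every `x ∈ A`. -/
def polarCone (A : Set E) : Set E :=
  {v | ∀ x ∈ A, ⟪v, x⟫ ≤ 0}

/-- The feasible directions of the set `C` at `x₀`. -/
def feasibleSet (C : Set E) (x₀ : E) : Set E :=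
  {z | x₀ + z ∈ C}

/-- The tangent cone of the set `C` at `x₀`. -/
def tangentCone (C : Set E) (x₀ : E) : Set E :=
  closure (coneOf (feasibleSet C x₀))

/-- The descent set of the function `f` at `x₀`. -/
def descentSet (f : E → ℝ) (x₀ : E) : Set E :=
  {z | f (x₀ + z) ≤ f x₀}

/-- The tangent cone of the function `f` at `x₀`. -/
def descentTangentCone (f : E → ℝ) (x₀ : E) : Set E :=
  closure (coneOf (descentSet f x₀))

/-- The set of subgradients of `f` at `x`. -/
def subdifferential (f : E → ℝ) (x : E) : Set E :=
  {s | ∀ y, f x + ⟪s, y - x⟫ ≤ f y}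

theorem exists_isNearestPoint [FiniteDimensional ℝ E] {C : Set E} (hne : C.Nonempty)
    (hcl : IsClosed C) (y : E) : ∃ x, IsNearestPoint C y x := by
  have : ProperSpace E := FiniteDimensional.proper ℝ E
  obtain ⟨x, hx, hd⟩ := hcl.exists_infDist_eq_dist hne y
  refine ⟨x, hx, fun z hz => ?_⟩
  rw [← dist_eq_norm, ← dist_eq_norm, ← hd]
  exact Metric.infDist_le_dist_of_mem hz

theorem isNearestPoint_prox [FiniteDimensional ℝ E] {C : Set E} (hne : C.Nonempty)
    (hcl : IsClosed C) (y : E) : IsNearestPoint C y (prox C y) := by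
  have h := exists_isNearestPoint hne hcl y
  rw [prox, dif_pos h]
  exact h.choose_spec

theorem IsNearestPoint.unique {C : Set E} (hconv : Convex ℝ C) {y a b : E}
    (ha : IsNearestPoint C y a) (hb : IsNearestPoint C y b) : a = b := by
  have hab : ‖y - a‖ = ‖y - b‖ := le_antisymm (ha.2 b hb.1) (hb.2 a ha.1)
  have hm : (1 / 2 : ℝ) • a + (1 / 2 : ℝ) • b ∈ C :=
    hconv ha.1 hb.1 (by norm_num) (by norm_num) (by norm_num)
  have h1 := ha.2 _ hm
  have e : (2 : ℝ) • (y - ((1 / 2 : ℝ) • a + (1 / 2 : ℝ) • b)) = (y - a) + (y - b) := by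
    module
  have h2 : 2 * ‖y - a‖ ≤ ‖(y - a) + (y - b)‖ := by
    rw [← e, norm_smul]; norm_num; simpa using h1
  have h3 := parallelogram_law_with_norm ℝ (y - a) (y - b)
  have h4 : ‖(y - a) - (y - b)‖ = 0 := by
    nlinarith [norm_nonneg (y - a), norm_nonneg ((y - a) - (y - b))]
  have h5 := norm_eq_zero.mp h4
  have h6 : b - a = 0 := by rw [← h5]; abel
  exact (sub_eq_zero.mp h6).symm

theorem IsNearestPoint.eq_prox [FiniteDimensional ℝ E] {C : Set E} (hconv : Convex ℝ C)
    (hcl : IsClosed C) {y x : E} (hx : IsNearestPoint C y x) : x = prox C y :=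
  hx.unique hconv (isNearestPoint_prox ⟨x, hx.1⟩ hcl y)

end Geometry

section Gaussian

variable {E : Type*} [NormedAddCommGroup E] [InnerProductSpace ℝ E] [FiniteDimensional ℝ E]
  [MeasurableSpace E] [BorelSpace E]

/-- The mean-squared distance `𝔼 [dist(g, A) ^ 2]` of a standard Gaussian vector `g` to a nonempty
set `A`. The integral is always finite, see `integrable_infDist_sq`. -/
noncomputable def meanSqDist (A : Set E) : ℝ :=
  ∫ g, (Metric.infDist g A) ^ 2 ∂(stdGaussian E)

theorem integrable_infDist_sq (A : Set E) :
    Integrable (fun g : E => (Metric.infDist g A) ^ 2) (stdGaussian E) := by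
  have h1 : MemLp (fun g : E => ‖g‖ + Metric.infDist (0 : E) A) 2 (stdGaussian E) :=
    (IsGaussian.memLp_two_id (μ := stdGaussian E)).norm.add (memLp_const _)
  have h2 : MemLp (fun g : E => Metric.infDist g A) 2 (stdGaussian E) := by
    refine h1.mono (Metric.continuous_infDist_pt A).aestronglyMeasurable (ae_of_all _ fun g => ?_)
    have h := Metric.infDist_le_infDist_add_dist (s := A) (x := g) (y := 0)
    rw [dist_zero_right] at h
    rw [Real.norm_of_nonneg Metric.infDist_nonneg,
      Real.norm_of_nonneg (add_nonneg (norm_nonneg _) Metric.infDist_nonneg)]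
    linarith
  exact h2.integrable_sq

/-- The normalized mean-squared error `𝔼 [‖prox C (x₀ + σ v) - x₀‖ ^ 2] / σ ^ 2`. -/
noncomputable def nmse {Ω : Type*} [MeasurableSpace Ω] (P : Measure Ω) (v : Ω → E)
    (C : Set E) (x₀ : E) (σ : ℝ) : ℝ :=
  (∫ ω, ‖prox C (x₀ + σ • v ω) - x₀‖ ^ 2 ∂P) / σ ^ 2

end Gaussian

end ConvexDenoising

open ConvexDenoising

/-!
Write `K` for the polar of the tangent cone `T` of `C` at `x₀`.

The variational inequality `⟪y - prox C y, z - prox C y⟫ ≤ 0` for `z ∈ C`, applied with `z = x₀` and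
`y = x₀ + σ v`, shows that the error `w = prox C (x₀ + σ v) - x₀`, an element of `T`, satisfies
`‖w‖ ^ 2 ≤ σ ⟪v, w⟫`. For any `p ∈ K` one has `⟪p, w⟫ ≤ 0`, hence `‖w‖ ≤ σ ‖v - p‖`, and so
`‖w‖ ≤ σ dist(v, K)` (`norm_prox_sub_le`). This gives integrability and the upper bound on the
normalized error for every `σ`.

For the limit, let `q` be the projection of `v` onto `T`. The rescaled error `w / σ` is the point of
`(C - x₀) / σ` nearest to `v`, and these sets increase to a dense subset of `T` as `σ ↓ 0`, so
`w / σ → q` (`tendsto_rescaled_error`). Since `v - q ∈ K`, also `dist(v, K) ≤ ‖q‖`, so the upper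
bound is attained in the limit (`tendsto_norm_rescaled_error`); dominated convergence finishes the
argument, and the supremum equals the limit because the limit is an upper bound.

For a sublevel set of a convex function, the polar cone of the descent directions is exactly the
cone generated by the subdifferential (`polarCone_descentTangentCone`). The nontrivial inclusion is
a Lagrange multiplier statement: if `u ≠ 0` satisfies `⟪u, x - x₀⟫ ≤ 0` wherever `f x < f x₀`, then
the origin of `ℝ²` lies outside the open convex set of pairs dominating `(f x - f x₀, -⟪u, x - x₀⟫)`
for some `x`, and a separating line yields a subgradient that is a positive multiple of `u`
(`exists_subgradient_of_separates`).
-/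

namespace ConvexDenoising

section Geometry

variable {E : Type*} [NormedAddCommGroup E] [InnerProductSpace ℝ E]

/-! ### Cones and polarity -/

theorem smul_mem_coneOf {A : Set E} {z : E} (hz : z ∈ coneOf A) {t : ℝ} (ht : 0 ≤ t) :
    t • z ∈ coneOf A := by
  obtain ⟨a, ha, s, hs, rfl⟩ := hz
  exact ⟨a, ha, t * s, mul_nonneg ht hs, smul_smul t s a⟩

theorem subset_coneOf (A : Set E) : A ⊆ coneOf A :=
  fun a ha => ⟨a, ha, 1, zero_le_one, (one_smul ℝ a).symm⟩

theorem convex_coneOf {A : Set E} (hA : Convex ℝ A) : Convex ℝ (coneOf A) := by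
  rintro _ ⟨a, ha, s, hs, rfl⟩ _ ⟨b, hb, t, ht, rfl⟩ α β hα hβ -
  have hαs := mul_nonneg hα hs
  have hβt := mul_nonneg hβ ht
  rcases (add_nonneg hαs hβt).eq_or_lt with h | h
  · refine ⟨a, ha, 0, le_rfl, ?_⟩
    rw [smul_smul, smul_smul, show α * s = 0 by linarith, show β * t = 0 by linarith]
    simp
  · refine ⟨(α * s / (α * s + β * t)) • a + (β * t / (α * s + β * t)) • b,
      hA ha hb (by positivity) (by positivity) (by field_simp), α * s + β * t, h.le, ?_⟩
    rw [smul_add, smul_smul, smul_smul, smul_smul, smul_smul, mul_div_cancel₀ _ h.ne',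
      mul_div_cancel₀ _ h.ne']

theorem polarCone_anti {A B : Set E} (h : A ⊆ B) : polarCone B ⊆ polarCone A :=
  fun _ hv x hx => hv x (h hx)

theorem polarCone_closure_coneOf (A : Set E) : polarCone (closure (coneOf A)) = polarCone A := by
  refine Subset.antisymm (polarCone_anti ((subset_coneOf A).trans subset_closure)) fun u hu => ?_
  have hcl : IsClosed {x : E | ⟪u, x⟫ ≤ 0} := isClosed_le (by fun_prop) continuous_const
  refine closure_minimal ?_ hcl
  rintro _ ⟨a, ha, t, ht, rfl⟩
  change ⟪u, t • a⟫ ≤ 0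
  rw [real_inner_smul_right]
  exact mul_nonpos_of_nonneg_of_nonpos ht (hu a ha)

theorem smul_mem_tangentCone {C : Set E} {x₀ z : E} (hz : z ∈ tangentCone C x₀) {t : ℝ}
    (ht : 0 ≤ t) : t • z ∈ tangentCone C x₀ :=
  map_mem_closure (continuous_const_smul t) hz fun _ hw => smul_mem_coneOf hw ht

theorem convex_feasibleSet {C : Set E} (hC : Convex ℝ C) (x₀ : E) :
    Convex ℝ (feasibleSet C x₀) :=
  hC.translate_preimage_right x₀

theorem convex_tangentCone {C : Set E} (hC : Convex ℝ C) (x₀ : E) :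
    Convex ℝ (tangentCone C x₀) :=
  (convex_coneOf (convex_feasibleSet hC x₀)).closure

theorem sub_mem_tangentCone {C : Set E} {x x₀ : E} (hx : x ∈ C) : x - x₀ ∈ tangentCone C x₀ :=
  subset_closure (subset_coneOf _ (by simpa [feasibleSet] using hx))

/-! ### Nearest points -/

/-- The variational inequality characterizing the projection onto a convex set. -/
theorem IsNearestPoint.inner_le_zero {C : Set E} (hC : Convex ℝ C) {y x : E}
    (h : IsNearestPoint C y x) {z : E} (hz : z ∈ C) : ⟪y - x, z - x⟫ ≤ 0 := by
  have : Nonempty C := ⟨⟨x, h.1⟩⟩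
  refine (norm_eq_iInf_iff_real_inner_le_zero hC h.1).1 (le_antisymm ?_ ?_) z hz
  · exact le_ciInf fun w => h.2 w w.2
  · exact ciInf_le ⟨0, by rintro _ ⟨w, rfl⟩; exact norm_nonneg _⟩ (⟨x, h.1⟩ : C)

/-- The residual of the projection onto a convex set that is closed under nonnegative scaling lies
in the polar cone. -/
theorem IsNearestPoint.sub_mem_polarCone {T : Set E} (hT : Convex ℝ T)
    (hsmul : ∀ z ∈ T, ∀ t : ℝ, 0 ≤ t → t • z ∈ T) {y q : E} (h : IsNearestPoint T y q) :
    y - q ∈ polarCone T := by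
  intro z hz
  by_contra! hpos
  -- The inequality `t * ⟪y - q, z⟫ ≤ ⟪y - q, q⟫` fails for large `t`.
  have key : ∀ t : ℝ, 0 ≤ t → t * ⟪y - q, z⟫ ≤ ⟪y - q, q⟫ := fun t ht => by
    have := h.inner_le_zero hT (hsmul z hz t ht)
    rw [inner_sub_right, real_inner_smul_right] at this
    linarith
  have h1 := key ((|⟪y - q, q⟫| + 1) / ⟪y - q, z⟫) (by positivity)
  rw [div_mul_cancel₀ _ hpos.ne'] at h1
  linarith [le_abs_self ⟪y - q, q⟫]

section FiniteDimensional

variable [FiniteDimensional ℝ E] {C : Set E}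

theorem prox_of_mem (hC : Convex ℝ C) (hcl : IsClosed C) {x : E} (hx : x ∈ C) : prox C x = x :=
  (IsNearestPoint.eq_prox hC hcl ⟨hx, fun z _ => by simp⟩).symm

theorem norm_prox_sub_prox_le (hne : C.Nonempty) (hC : Convex ℝ C) (hcl : IsClosed C) (y z : E) :
    ‖prox C y - prox C z‖ ≤ ‖y - z‖ := by
  have hy := isNearestPoint_prox hne hcl y
  have hz := isNearestPoint_prox hne hcl z
  have h1 := hy.inner_le_zero hC hz.1
  have h2 := hz.inner_le_zero hC hy.1
  set a := prox C y
  set b := prox C z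
  have e : ⟪y - z, a - b⟫ = ‖a - b‖ ^ 2 - ⟪y - a, b - a⟫ - ⟪z - b, a - b⟫ := by
    rw [← real_inner_self_eq_norm_sq]
    simp only [inner_sub_left, inner_sub_right]
    ring
  have h3 := real_inner_le_norm (y - z) (a - b)
  by_contra! hlt
  nlinarith [norm_nonneg (y - z), norm_nonneg (a - b)]

theorem continuous_prox (hne : C.Nonempty) (hC : Convex ℝ C) (hcl : IsClosed C) :
    Continuous (prox C) :=
  (LipschitzWith.of_dist_le_mul (K := 1) fun y z => by
    simpa [dist_eq_norm] using norm_prox_sub_prox_le hne hC hcl y z).continuous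

/-! ### The projection error at a fixed noise vector -/

/-- The projection error at noise level `σ` is at most `σ` times the distance of the noise vector
to the polar of the tangent cone. -/
theorem norm_prox_sub_le (hC : Convex ℝ C) (hcl : IsClosed C) {x₀ : E} (hx₀ : x₀ ∈ C) {σ : ℝ}
    (hσ : 0 ≤ σ) (v : E) :
    ‖prox C (x₀ + σ • v) - x₀‖ ≤ σ * Metric.infDist v (polarCone (tangentCone C x₀)) := by
  have hp := isNearestPoint_prox ⟨x₀, hx₀⟩ hcl (x₀ + σ • v)
  have h1 := hp.inner_le_zero hC hx₀
  have hwT : prox C (x₀ + σ • v) - x₀ ∈ tangentCone C x₀ := sub_mem_tangentCone hp.1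
  set w := prox C (x₀ + σ • v) - x₀
  have h2 : ‖w‖ ^ 2 ≤ σ * ⟪v, w⟫ := by
    rw [show x₀ + σ • v - prox C (x₀ + σ • v) = σ • v - w by simp only [w]; abel,
      show x₀ - prox C (x₀ + σ • v) = -w by simp only [w]; abel, inner_neg_right, inner_sub_left,
      real_inner_smul_left, real_inner_self_eq_norm_sq] at h1
    linarith
  have hbound : ∀ p ∈ polarCone (tangentCone C x₀), ‖w‖ ≤ σ * ‖v - p‖ := fun p hpK => by
    have h3 : ⟪v, w⟫ ≤ ‖v - p‖ * ‖w‖ := by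
      have h4 := real_inner_le_norm (v - p) w
      rw [inner_sub_left] at h4
      linarith [hpK w hwT]
    by_contra! hlt
    have hw : 0 < ‖w‖ := (by positivity : 0 ≤ σ * ‖v - p‖).trans_lt hlt
    nlinarith [mul_le_mul_of_nonneg_left h3 hσ, mul_pos (sub_pos.2 hlt) hw]
  rcases hσ.eq_or_lt with rfl | hσ
  · simpa using hbound 0 (fun x _ => by simp)
  · rw [← div_le_iff₀' hσ]
    refine (Metric.le_infDist ⟨0, fun x _ => by simp⟩).2 fun p hpK => ?_
    rw [div_le_iff₀' hσ, dist_eq_norm]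
    exact hbound p hpK

theorem prox_error_sq_le (hC : Convex ℝ C) (hcl : IsClosed C) (hx₀ : x₀ ∈ C) {σ : ℝ}
    (hσ : 0 ≤ σ) (v : E) :
    ‖prox C (x₀ + σ • v) - x₀‖ ^ 2 ≤
      σ ^ 2 * Metric.infDist v (polarCone (tangentCone C x₀)) ^ 2 := by
  rw [← mul_pow]
  exact pow_le_pow_left₀ (norm_nonneg _) (norm_prox_sub_le hC hcl hx₀ hσ v) 2

/-- Near noise level zero the rescaled projection error tends to the projection of the noise vector
onto the tangent cone. -/
theorem tendsto_rescaled_error (hC : Convex ℝ C) (hcl : IsClosed C) {x₀ : E} (hx₀ : x₀ ∈ C)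
    {v q : E} (hq : IsNearestPoint (tangentCone C x₀) v q) :
    Tendsto (fun σ : ℝ => σ⁻¹ • (prox C (x₀ + σ • v) - x₀)) (𝓝[>] 0) (𝓝 q) := by
  rw [Metric.tendsto_nhds]
  intro ε hε
  have hψ : Continuous fun z : E => ‖v - z‖ ^ 2 - ‖v - q‖ ^ 2 := by fun_prop
  obtain ⟨z, hzε, a, ha, t, ht, rfl⟩ : ({z : E | ‖v - z‖ ^ 2 - ‖v - q‖ ^ 2 < ε ^ 2} ∩
      coneOf (feasibleSet C x₀)).Nonempty :=
    mem_closure_iff.1 hq.1 _ (isOpen_lt hψ continuous_const)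
      (by rw [mem_ofPred_eq, sub_self]; positivity)
  have hsmall : ∀ᶠ σ : ℝ in 𝓝[>] 0, σ * t < 1 := by
    have : Tendsto (fun σ : ℝ => σ * t) (𝓝 0) (𝓝 (0 * t)) := tendsto_id.mul_const t
    rw [zero_mul] at this
    exact (this.mono_left nhdsWithin_le_nhds).eventually_lt_const one_pos
  filter_upwards [hsmall, self_mem_nhdsWithin] with σ hσt (hσ : 0 < σ)
  have hp := isNearestPoint_prox ⟨x₀, hx₀⟩ hcl (x₀ + σ • v)
  set b := σ⁻¹ • (prox C (x₀ + σ • v) - x₀) with hb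
  have hσb : σ • b = prox C (x₀ + σ • v) - x₀ := by rw [hb, smul_inv_smul₀ hσ.ne']
  have hbT : b ∈ tangentCone C x₀ :=
    smul_mem_tangentCone (sub_mem_tangentCone hp.1) (inv_nonneg.2 hσ.le)
  -- For small `σ` the point `σ • t • a` is still a feasible direction.
  have hfeas : x₀ + (σ * t) • a ∈ C := by
    have h := convex_feasibleSet hC x₀ (show (0 : E) ∈ feasibleSet C x₀ by simpa [feasibleSet])
      ha (sub_nonneg.2 hσt.le) (mul_nonneg hσ.le ht) (sub_add_cancel _ _)
    rwa [smul_zero, zero_add] at h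
  have hle : ‖v - b‖ ≤ ‖v - t • a‖ := by
    have h := hp.2 _ hfeas
    rw [show x₀ + σ • v - prox C (x₀ + σ • v) = σ • (v - b) by rw [smul_sub, hσb]; abel,
      show x₀ + σ • v - (x₀ + (σ * t) • a) = σ • (v - t • a) by rw [smul_sub, smul_smul]; abel,
      norm_smul, norm_smul] at h
    exact le_of_mul_le_mul_left h (norm_pos_iff.2 hσ.ne')
  have hvar := hq.inner_le_zero (convex_tangentCone hC x₀) hbT
  have hexp : ‖v - b‖ ^ 2 = ‖v - q‖ ^ 2 - 2 * ⟪v - q, b - q⟫ + ‖b - q‖ ^ 2 := by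
    rw [← norm_sub_sq_real]
    congr 2
    abel
  rw [dist_eq_norm]
  refine lt_of_pow_lt_pow_left₀ 2 hε.le ?_
  have hsq : ‖v - b‖ ^ 2 ≤ ‖v - t • a‖ ^ 2 := by gcongr
  rw [mem_ofPred_eq] at hzε
  linarith

theorem tendsto_norm_rescaled_error (hC : Convex ℝ C) (hcl : IsClosed C) {x₀ : E} (hx₀ : x₀ ∈ C)
    (v : E) :
    Tendsto (fun σ : ℝ => ‖prox C (x₀ + σ • v) - x₀‖ / σ) (𝓝[>] 0)
      (𝓝 (Metric.infDist v (polarCone (tangentCone C x₀)))) := by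
  obtain ⟨q, hq⟩ := exists_isNearestPoint (C := tangentCone C x₀)
    ⟨x₀ - x₀, sub_mem_tangentCone hx₀⟩ isClosed_closure v
  have hlim : Tendsto (fun σ : ℝ => ‖prox C (x₀ + σ • v) - x₀‖ / σ) (𝓝[>] 0) (𝓝 ‖q‖) := by
    refine (tendsto_rescaled_error hC hcl hx₀ hq).norm.congr' ?_
    filter_upwards [self_mem_nhdsWithin] with σ (hσ : 0 < σ)
    rw [norm_smul, norm_inv, Real.norm_of_nonneg hσ.le, inv_mul_eq_div]
  have hle : ‖q‖ ≤ Metric.infDist v (polarCone (tangentCone C x₀)) := by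
    refine le_of_tendsto hlim ?_
    filter_upwards [self_mem_nhdsWithin] with σ (hσ : 0 < σ)
    rw [div_le_iff₀' hσ]
    exact norm_prox_sub_le hC hcl hx₀ hσ.le v
  have hge : Metric.infDist v (polarCone (tangentCone C x₀)) ≤ ‖q‖ := by
    have h := Metric.infDist_le_dist_of_mem (x := v)
      (hq.sub_mem_polarCone (convex_tangentCone hC x₀) fun z hz t => smul_mem_tangentCone hz)
    rwa [dist_eq_norm, sub_sub_cancel] at h
  rwa [le_antisymm hge hle]

end FiniteDimensional

/-! ### The polar of the descent cone -/

/-- A Lagrange multiplier rule: a nonzero `u` that is nonpositive on the directions of strict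
descent is a nonnegative multiple of a subgradient. -/
theorem exists_subgradient_of_separates {f : E → ℝ} (hf : ConvexOn ℝ univ f) {x₀ u : E}
    (hmin : ¬ IsMinOn f univ x₀) (hu : u ≠ 0) (hsep : ∀ x, f x < f x₀ → ⟪u, x - x₀⟫ ≤ 0) :
    ∃ s ∈ subdifferential f x₀, ∃ t : ℝ, 0 ≤ t ∧ u = t • s := by
  set S : Set (ℝ × ℝ) := {p | ∃ x, f x - f x₀ < p.1 ∧ -⟪u, x - x₀⟫ < p.2} with hS
  have hconv : Convex ℝ S := by
    rintro ⟨a, b⟩ ⟨x, hxa, hxb⟩ ⟨c, d⟩ ⟨y, hyc, hyd⟩ α β hα hβ hαβ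
    refine ⟨α • x + β • y, ?_, ?_⟩
    · have h := hf.2 (mem_univ x) (mem_univ y) hα hβ hαβ
      simp only [smul_eq_mul, Prod.smul_mk, Prod.mk_add_mk] at h hxa hyc ⊢
      have e : f x₀ = α * f x₀ + β * f x₀ := by rw [← add_mul, hαβ, one_mul]
      rcases hα.eq_or_lt with rfl | hα
      · rw [zero_add] at hαβ
        subst hαβ
        linarith
      · nlinarith [mul_lt_mul_of_pos_left hxa hα, mul_le_mul_of_nonneg_left hyc.le hβ]
    · have e : ⟪u, α • x + β • y - x₀⟫ = α * ⟪u, x - x₀⟫ + β * ⟪u, y - x₀⟫ := by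
        simp only [inner_sub_right, inner_add_right, real_inner_smul_right]
        linear_combination ⟪u, x₀⟫ * hαβ
      simp only [smul_eq_mul, Prod.smul_mk, Prod.mk_add_mk] at hxb hyd ⊢
      rw [e]
      rcases hα.eq_or_lt with rfl | hα
      · rw [zero_add] at hαβ
        subst hαβ
        linarith
      · nlinarith [mul_lt_mul_of_pos_left hxb hα, mul_le_mul_of_nonneg_left hyd.le hβ]
  have hopen : IsOpen S := by
    rw [hS, ofPred_exists]
    exact isOpen_iUnion fun x => (isOpen_lt continuous_const continuous_fst).inter
      (isOpen_lt continuous_const continuous_snd)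
  have h0 : (0 : ℝ × ℝ) ∉ S := by
    rintro ⟨x, h1, h2⟩
    simp only [Prod.fst_zero, Prod.snd_zero] at h1 h2
    linarith [hsep x (by linarith)]
  obtain ⟨l, hl⟩ := geometric_hahn_banach_point_open hconv hopen h0
  obtain ⟨α, β, hαβ⟩ : ∃ α β : ℝ, ∀ a b, l (a, b) = α * a + β * b := by
    refine ⟨l (1, 0), l (0, 1), fun a b => ?_⟩
    have : ((a, b) : ℝ × ℝ) = a • (1, 0) + b • (0, 1) := by simp
    rw [this, map_add, map_smul, map_smul, smul_eq_mul, smul_eq_mul]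
    ring
  have hpos : ∀ x a b, f x - f x₀ < a → -⟪u, x - x₀⟫ < b → 0 < α * a + β * b :=
    fun x a b ha hb => by
      rw [← hαβ]
      simpa using hl (a, b) ⟨x, ha, hb⟩
  -- The set `S` is closed under increasing either coordinate, so both multipliers are nonnegative.
  have hα : 0 ≤ α := by
    by_contra! h
    have := hpos x₀ ((|β| + 1) / (-α)) 1
      (by rw [sub_self]; have := neg_pos.2 h; positivity) (by simp)
    rw [show α * ((|β| + 1) / (-α)) = -(|β| + 1) by field_simp [h.ne]] at this
    linarith [le_abs_self β]
  have hβ : 0 ≤ β := by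
    by_contra! h
    have := hpos x₀ 1 ((|α| + 1) / (-β)) (by simp)
      (by rw [sub_self, inner_zero_right, neg_zero]; have := neg_pos.2 h; positivity)
    rw [show β * ((|α| + 1) / (-β)) = -(|α| + 1) by field_simp [h.ne]] at this
    linarith [le_abs_self α]
  have hlag : ∀ x, β * ⟪u, x - x₀⟫ ≤ α * (f x - f x₀) := fun x => by
    refine le_of_forall_pos_le_add fun ε hε => ?_
    have h := hpos x (f x - f x₀ + ε / (α + β + 1)) (-⟪u, x - x₀⟫ + ε / (α + β + 1))
      (by linarith [show 0 < ε / (α + β + 1) by positivity])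
      (by linarith [show 0 < ε / (α + β + 1) by positivity])
    have h' : (α + β) * (ε / (α + β + 1)) ≤ ε := by
      rw [mul_div_assoc', div_le_iff₀ (by positivity)]
      nlinarith
    nlinarith
  obtain ⟨x₁, hx₁⟩ : ∃ x, f x < f x₀ := by
    simpa [isMinOn_iff] using hmin
  have hne : 0 < α ∨ 0 < β := by
    by_contra! h
    have := hpos x₀ 1 1 (by simp) (by simp)
    linarith
  have hβ' : 0 < β := by
    refine hβ.lt_of_ne fun h => ?_
    subst h
    have hα' : 0 < α := by simpa using hne
    nlinarith [hlag x₁]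
  have hα' : 0 < α := by
    refine hα.lt_of_ne fun h => ?_
    subst h
    have h1 := hlag (x₀ + u)
    rw [add_sub_cancel_left, zero_mul] at h1
    have h2 : 0 < ⟪u, u⟫ := real_inner_self_pos.2 hu
    nlinarith
  refine ⟨(β / α) • u, fun y => ?_, α / β, by positivity, ?_⟩
  · have h1 := hlag y
    rw [real_inner_smul_left, div_mul_eq_mul_div]
    have : β * ⟪u, y - x₀⟫ / α ≤ f y - f x₀ := by rwa [div_le_iff₀' hα']
    linarith
  · rw [smul_smul, div_mul_div_cancel₀ hβ'.ne', div_self hα'.ne', one_smul]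

/-- A hyperplane through `x₀` supporting the open strict sublevel set has a nonzero normal, to which
the multiplier rule applies. -/
theorem subdifferential_nonempty {f : E → ℝ} (hf : ConvexOn ℝ univ f) (hcont : Continuous f)
    [CompleteSpace E] {x₀ : E} (hmin : ¬ IsMinOn f univ x₀) :
    (subdifferential f x₀).Nonempty := by
  have hconv : Convex ℝ {x | f x < f x₀} := by simpa using hf.convex_lt (f x₀)
  obtain ⟨l, hl⟩ := geometric_hahn_banach_open_point hconv
    (isOpen_lt hcont continuous_const) (lt_irrefl (f x₀))
  have hin : ∀ x, ⟪(InnerProductSpace.toDual ℝ E).symm l, x⟫ = l x :=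
    fun x => InnerProductSpace.toDual_symm_apply
  obtain ⟨x₁, hx₁⟩ : ∃ x, f x < f x₀ := by
    simpa [isMinOn_iff] using hmin
  obtain ⟨s, hs, -⟩ := exists_subgradient_of_separates hf hmin
    (u := (InnerProductSpace.toDual ℝ E).symm l)
    (fun h => by
      have h1 := hl x₁ hx₁
      rw [← hin, ← hin, h, inner_zero_left, inner_zero_left] at h1
      exact lt_irrefl _ h1)
    (fun x hx => by
      rw [hin, map_sub]
      exact (sub_neg.2 (hl x hx)).le)
  exact ⟨s, hs⟩

theorem polarCone_descentTangentCone {f : E → ℝ} (hf : ConvexOn ℝ univ f) (hcont : Continuous f)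
    [CompleteSpace E] {x₀ : E} (hmin : ¬ IsMinOn f univ x₀) :
    polarCone (descentTangentCone f x₀) = coneOf (subdifferential f x₀) := by
  rw [descentTangentCone, polarCone_closure_coneOf]
  refine Subset.antisymm (fun u hu => ?_) ?_
  · rcases eq_or_ne u 0 with rfl | hne
    · obtain ⟨s, hs⟩ := subdifferential_nonempty hf hcont hmin
      exact ⟨s, hs, 0, le_rfl, (zero_smul ℝ s).symm⟩
    · exact exists_subgradient_of_separates hf hmin hne fun x hx =>
        hu _ (by rw [descentSet, mem_ofPred_eq, add_sub_cancel]; exact hx.le)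
  · rintro _ ⟨s, hs, t, ht, rfl⟩ z (hz : f (x₀ + z) ≤ f x₀)
    have h := hs (x₀ + z)
    rw [add_sub_cancel_left] at h
    rw [real_inner_smul_left]
    exact mul_nonpos_of_nonneg_of_nonpos ht (by linarith)

end Geometry

/-! ### The normalized mean-squared error -/

section Gaussian

variable {E : Type*} [NormedAddCommGroup E] [InnerProductSpace ℝ E] [FiniteDimensional ℝ E]
  [MeasurableSpace E] [BorelSpace E] {Ω : Type*} [MeasurableSpace Ω] {P : Measure Ω} {v : Ω → E}

theorem integral_infDist_sq_eq_meanSqDist (hv : HasLaw v (stdGaussian E) P) (A : Set E) :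
    ∫ ω, Metric.infDist (v ω) A ^ 2 ∂P = meanSqDist A :=
  hv.integral_comp (f := fun g => Metric.infDist g A ^ 2)
    (integrable_infDist_sq A).aestronglyMeasurable

theorem integrable_infDist_sq_comp (hv : HasLaw v (stdGaussian E) P) (A : Set E) :
    Integrable (fun ω => Metric.infDist (v ω) A ^ 2) P := by
  have h := integrable_infDist_sq A
  rw [← hv.map_eq] at h
  exact h.comp_aemeasurable hv.aemeasurable

variable {C : Set E} {x₀ : E}

theorem aestronglyMeasurable_prox_error (hv : AEMeasurable v P) (hC : Convex ℝ C)
    (hcl : IsClosed C) (hx₀ : x₀ ∈ C) (σ : ℝ) :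
    AEStronglyMeasurable (fun ω => ‖prox C (x₀ + σ • v ω) - x₀‖ ^ 2) P := by
  have hprox := continuous_prox ⟨x₀, hx₀⟩ hC hcl
  have h : Continuous fun y : E => ‖prox C (x₀ + σ • y) - x₀‖ ^ 2 := by fun_prop
  exact h.comp_aestronglyMeasurable hv.aestronglyMeasurable

theorem integrable_prox_error_sq (hv : HasLaw v (stdGaussian E) P) (hC : Convex ℝ C)
    (hcl : IsClosed C) (hx₀ : x₀ ∈ C) {σ : ℝ} (hσ : 0 ≤ σ) :
    Integrable (fun ω => ‖prox C (x₀ + σ • v ω) - x₀‖ ^ 2) P := by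
  refine ((integrable_infDist_sq_comp hv (polarCone (tangentCone C x₀))).const_mul (σ ^ 2)).mono'
    (aestronglyMeasurable_prox_error hv.aemeasurable hC hcl hx₀ σ) (ae_of_all _ fun ω => ?_)
  rw [Real.norm_of_nonneg (by positivity)]
  exact prox_error_sq_le hC hcl hx₀ hσ (v ω)

theorem nmse_le_meanSqDist (hv : HasLaw v (stdGaussian E) P) (hC : Convex ℝ C)
    (hcl : IsClosed C) (hx₀ : x₀ ∈ C) {σ : ℝ} (hσ : 0 < σ) :
    nmse P v C x₀ σ ≤ meanSqDist (polarCone (tangentCone C x₀)) := by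
  rw [nmse, div_le_iff₀' (by positivity), ← integral_infDist_sq_eq_meanSqDist hv,
    ← integral_const_mul]
  exact integral_mono (integrable_prox_error_sq hv hC hcl hx₀ hσ.le)
    ((integrable_infDist_sq_comp hv _).const_mul _)
    fun ω => prox_error_sq_le hC hcl hx₀ hσ.le (v ω)

theorem tendsto_nmse (hv : HasLaw v (stdGaussian E) P) (hC : Convex ℝ C) (hcl : IsClosed C)
    (hx₀ : x₀ ∈ C) :
    Tendsto (nmse P v C x₀) (𝓝[>] 0) (𝓝 (meanSqDist (polarCone (tangentCone C x₀)))) := by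
  rw [← integral_infDist_sq_eq_meanSqDist hv]
  have hnmse : nmse P v C x₀ = fun σ => ∫ ω, ‖prox C (x₀ + σ • v ω) - x₀‖ ^ 2 / σ ^ 2 ∂P := by
    funext σ
    rw [nmse, integral_div]
  rw [hnmse]
  refine tendsto_integral_filter_of_dominated_convergence
    (fun ω => Metric.infDist (v ω) (polarCone (tangentCone C x₀)) ^ 2) (Eventually.of_forall
      fun σ => by
        simp only [div_eq_mul_inv]
        exact (aestronglyMeasurable_prox_error hv.aemeasurable hC hcl hx₀ σ).mul_const _)
    ?_ (integrable_infDist_sq_comp hv _) (ae_of_all _ fun ω => ?_)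
  · filter_upwards [self_mem_nhdsWithin] with σ (hσ : 0 < σ)
    refine ae_of_all _ fun ω => ?_
    rw [Real.norm_of_nonneg (by positivity), div_le_iff₀' (by positivity)]
    exact prox_error_sq_le hC hcl hx₀ hσ.le (v ω)
  · simp only [← div_pow]
    exact (tendsto_norm_rescaled_error hC hcl hx₀ (v ω)).pow 2

theorem isLUB_nmse (hv : HasLaw v (stdGaussian E) P) (hC : Convex ℝ C) (hcl : IsClosed C)
    (hx₀ : x₀ ∈ C) :
    IsLUB (nmse P v C x₀ '' Ioi 0) (meanSqDist (polarCone (tangentCone C x₀))) := by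
  refine ⟨?_, fun b hb => le_of_tendsto (tendsto_nmse hv hC hcl hx₀) ?_⟩
  · rintro _ ⟨σ, hσ, rfl⟩
    exact nmse_le_meanSqDist hv hC hcl hx₀ hσ
  · filter_upwards [self_mem_nhdsWithin] with σ hσ
    exact hb ⟨σ, hσ, rfl⟩

end Gaussian

end ConvexDenoising

theorem theorem2 (n : ℕ) (x₀ : EuclideanSpace ℝ (Fin n))
    {Ω : Type*} [MeasurableSpace Ω] (P : Measure Ω) [IsProbabilityMeasure P]
    (v : Ω → EuclideanSpace ℝ (Fin n))
    (hv : HasLaw v (stdGaussian (EuclideanSpace ℝ (Fin n))) P) :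
    (∀ C : Set (EuclideanSpace ℝ (Fin n)), C.Nonempty → Convex ℝ C → IsClosed C → x₀ ∈ C →
      (∀ σ : ℝ, 0 < σ → Integrable (fun ω => ‖prox C (x₀ + σ • v ω) - x₀‖ ^ 2) P) ∧
      IsLUB (nmse P v C x₀ '' Ioi 0) (meanSqDist (polarCone (tangentCone C x₀))) ∧
      Tendsto (nmse P v C x₀) (𝓝[>] 0) (𝓝 (meanSqDist (polarCone (tangentCone C x₀))))) ∧
    (∀ f : EuclideanSpace ℝ (Fin n) → ℝ, ConvexOn ℝ univ f → ¬ IsMinOn f univ x₀ →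
      (∀ σ : ℝ, 0 < σ →
        Integrable (fun ω => ‖prox {x | f x ≤ f x₀} (x₀ + σ • v ω) - x₀‖ ^ 2) P) ∧
      IsLUB (nmse P v {x | f x ≤ f x₀} x₀ '' Ioi 0)
        (meanSqDist (polarCone (descentTangentCone f x₀))) ∧
      Tendsto (nmse P v {x | f x ≤ f x₀} x₀) (𝓝[>] 0)
        (𝓝 (meanSqDist (polarCone (descentTangentCone f x₀)))) ∧
      meanSqDist (polarCone (descentTangentCone f x₀)) =
        meanSqDist (coneOf (subdifferential f x₀))) := by
  refine ⟨fun C _ hC hcl hx₀ => ⟨fun σ hσ => integrable_prox_error_sq hv hC hcl hx₀ hσ.le,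
    isLUB_nmse hv hC hcl hx₀, tendsto_nmse hv hC hcl hx₀⟩, fun f hf hmin => ?_⟩
  have hcont : Continuous f := hf.locallyLipschitz.continuous
  have hC : Convex ℝ {x | f x ≤ f x₀} := by simpa using hf.convex_le (f x₀)
  have hcl : IsClosed {x | f x ≤ f x₀} := isClosed_le hcont continuous_const
  have hx₀ : x₀ ∈ {x | f x ≤ f x₀} := le_refl (f x₀)
  -- The feasible directions of the sublevel set are by definition the descent set of `f`.
  have hT : tangentCone {x | f x ≤ f x₀} x₀ = descentTangentCone f x₀ := rfl
  rw [← hT]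
  refine ⟨fun σ hσ => integrable_prox_error_sq hv hC hcl hx₀ hσ.le,
    isLUB_nmse hv hC hcl hx₀, tendsto_nmse hv hC hcl hx₀, ?_⟩
  rw [hT, polarCone_descentTangentCone hf hcont hmin]
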